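/- Let $(X,\mathscr B,\nu)$ be a $\sigma$-finite measure space and let $\mathscr B_{fin}=\{A\in\mathscr B:\nu(A)<\infty\}$. Let $P$ be a Markov kernel on $X$ (each $P(x,\cdot)$ is a probability measure, measurably in $x$) that is reversible with respect to $\nu$, i.e. $\int_A P(x,B)\,d\nu(x)=\int_B P(y,A)\,d\nu(y)$ for all $A,B\in\mathscr B_{fin}$. Put $P_0(x,\cdot)=\delta_x$, $P_{n+1}(x,A)=\int_X P(x,dy)\,P_n(y,A)$ and $G(x,A)=\sum_{n=0}^\infty P_n(x,A)$. Assume that $P$ is transient, i.e. for every $B\in\mathscr B_{fin}$ the series $G(x,B)$ converges for $\nu$-a.e. $x$, and $\int_A G(x,B)\,d\nu(x)<\infty$ for all $A,B\in\mathscr B_{fin}$. For $A,B\in\mathscr B_{fin}$ set $$K(A,B)=\int_A G(x,B)\,d\nu(x).$$ Then $K$ is positive definite on $\mathscr B_{fin}\times\mathscr B_{fin}$: $\sum_{i,j}\alpha_i\alpha_jK(A_i,A_j)\ge 0$ for all $n$, all $\alpha_1,\dots,\alpha_n\in\mathbb R$ and all $A_1,\dots,A_n\in\mathscr B_{fin}$.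 Moreover, the formula $(P_{(\nu)}\varphi)(x)=\int_X\varphi(y)\,P(x,dy)$ (the integral existing for $\nu$-a.e. $x$) defines a self-adjoint operator $P_{(\nu)}$ on the real Hilbert space $L^2(\nu)$ with $\|P_{(\nu)}\|\le 1$. The operator $I-P_{(\nu)}$ has an injective positive square root, so that the (possibly unbounded) operator $(I-P_{(\nu)})^{-1/2}$, the inverse of that square root with domain its range, is well defined, uniquely determined by $I-P_{(\nu)}$. For every $A\in\mathscr B_{fin}$ the indicator function $\chi_A$ lies in the domain of $(I-P_{(\nu)})^{-1/2}$, and the functions $k_A=(I-P_{(\nu)})^{-1/2}\chi_A\in L^2(\nu)$ satisfy $$K(A,B)=\int_X k_A(x)\,k_B(x)\,d\nu(x)\qquad\text{for all }A,B\in\mathscr B_{fin}.$$ -/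

import Mathlib

/-!
The power series of `1 - √(1 - z)` has nonnegative coefficients with sum at most `1`. For a
self-adjoint contraction `T` it therefore converges at `T` to some `W` with `‖W‖ ≤ 1`, which makes
`S = 1 - W` a positive square root of `1 - T`, the only one because `W` commutes with everything
that commutes with `T`.

If the series `∑ ⟪f, T ^ n f⟫` converges, put `u_n = ∑_{i < n} T ^ i f`. By the telescoping identity
`⟪S u_m, S u_n⟫ = s_m + s_n - s_{m + n}`, where `s` denotes the partial sums of the series, the
sequence `S u_n` is Cauchy, and `S (S u_n) = f - T ^ n f` tends to `f`. So the limit of `S u_n` is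
`(1 - T)^(-1/2) f`, and the inner products of two such limits are the sums `∑ ⟪f, T ^ n g⟫`.

For the operator of a reversible Markov kernel and for indicator functions `f` and `g` these sums
are the values of the Green kernel. Reversibility says that the measure `ν ⊗ₘ P` is symmetric, and
the operator is the adjoint of the pullback along `Prod.fst` composed with the pullback along
`Prod.snd`.
-/

open MeasureTheory ProbabilityTheory
open scoped ENNReal

namespace TransientMarkov

/-- The measurable sets of finite `ν`-measure. -/
abbrev BFin {X : Type*} [MeasurableSpace X] (ν : Measure X) : Type _ :=
  {A : Set X // MeasurableSet A ∧ ν A < ∞}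

/-- Positive definiteness of a real-valued function of two sets of finite measure. -/
def IsPosDefKernel {X : Type*} [MeasurableSpace X] {ν : Measure X}
    (K : BFin ν → BFin ν → ℝ) : Prop :=
  ∀ (n : ℕ) (α : Fin n → ℝ) (A : Fin n → BFin ν),
    0 ≤ ∑ i, ∑ j, α i * α j * K (A i) (A j)

/-- The system `k` of elements of (real) `L²(ν)` is a realization (factorization) of `K`. -/
def IsL2Realization {X : Type*} [MeasurableSpace X] {ν : Measure X}
    (K : BFin ν → BFin ν → ℝ) (k : BFin ν → Lp ℝ 2 ν) : Prop :=
  ∀ A B : BFin ν, K A B = ∫ x, k A x * k B x ∂ν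

/-- Reversibility of a kernel relative to `ν`, tested on sets of finite measure. -/
def Reversible {X : Type*} [MeasurableSpace X] (P : Kernel X X) (ν : Measure X) : Prop :=
  ∀ A B : BFin ν, ∫⁻ x in (A : Set X), P x B ∂ν = ∫⁻ y in (B : Set X), P y A ∂ν

/-- The Green function `G(x, A) = ∑ₙ Pₙ(x, A)`. Here `P ^ n` is the `n`-step kernel, the power for
composition of kernels: `P ^ 0` sends `x` to the Dirac mass at `x`, and
`(P ^ (n + 1)) x A = ∫⁻ y, (P ^ n) y A ∂(P x)`. -/
noncomputable def green {X : Type*} [MeasurableSpace X] (P : Kernel X X) (x : X) (A : Set X) :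
    ℝ≥0∞ :=
  ∑' n : ℕ, (P ^ n) x A

/-- Transience: for each set of finite measure the Green series converges `ν`-almost everywhere,
and its integrals over sets of finite measure are finite. -/
def Transient {X : Type*} [MeasurableSpace X] (P : Kernel X X) (ν : Measure X) : Prop :=
  (∀ B : BFin ν, ∀ᵐ x ∂ν, green P x B < ∞) ∧
    ∀ A B : BFin ν, ∫⁻ x in (A : Set X), green P x B ∂ν < ∞

/-- The kernel `K(A, B) = ∫_A G(x, B) dν(x)`, a real number for a transient `P`. -/
noncomputable def greenKernel {X : Type*} [MeasurableSpace X] (P : Kernel X X) (ν : Measure X)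
    (A B : BFin ν) : ℝ :=
  (∫⁻ x in (A : Set X), green P x B ∂ν).toReal

/-- The indicator function of `A` as an element of `L²(ν)`. -/
noncomputable def chi {X : Type*} [MeasurableSpace X] (ν : Measure X) (A : BFin ν) : Lp ℝ 2 ν :=
  indicatorConstLp 2 A.2.1 A.2.2.ne (1 : ℝ)

/-- `T` is the operator on `L²(ν)` given by `(T φ)(x) = ∫ φ(y) P(x, dy)`: for every
square-integrable `φ` the integral exists for almost every `x`, and it represents `T φ`. -/
def IsInducedOperator {X : Type*} [MeasurableSpace X] (P : Kernel X X) (ν : Measure X)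
    (T : Lp ℝ 2 ν →L[ℝ] Lp ℝ 2 ν) : Prop :=
  ∀ (φ : X → ℝ) (hφ : MemLp φ 2 ν),
    (∀ᵐ x ∂ν, Integrable φ (P x)) ∧ T (hφ.toLp φ) =ᵐ[ν] fun x => ∫ y, φ y ∂(P x)

/-- `R` is the (possibly unbounded, partially defined) operator `T ^ (-1/2)`: the inverse, with
domain the range of `S`, of an injective positive bounded square root `S` of `T`. -/
def IsInvSqrt {H : Type*} [NormedAddCommGroup H] [InnerProductSpace ℝ H]
    (R : H →ₗ.[ℝ] H) (T : H →L[ℝ] H) : Prop :=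
  ∃ S : H →L[ℝ] H, S.IsPositive ∧ S * S = T ∧ Function.Injective S ∧
    R = ((S : H →ₗ[ℝ] H).toPMap ⊤).inverse

end TransientMarkov

namespace TransientMarkov

section PowerSeries

open Finset

theorem sum_range_catalan_div (N : ℕ) :
    ∑ n ∈ range N, (catalan n : ℝ) / (2 * 4 ^ n) = 1 - (N.centralBinom : ℝ) / 4 ^ N := by
  induction N with
  | zero => simp
  | succ n ih =>
    have hcatalan : ((n : ℝ) + 1) * catalan n = n.centralBinom := by
      exact_mod_cast succ_mul_catalan_eq_centralBinom n
    have hbinom : ((n : ℝ) + 1) * (n + 1).centralBinom = 2 * (2 * n + 1) * n.centralBinom := by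
      exact_mod_cast Nat.succ_mul_centralBinom_succ n
    have hsucc : ((n + 1).centralBinom : ℝ) = 2 * (2 * n + 1) * catalan n := by
      refine mul_left_cancel₀ (by positivity : (n : ℝ) + 1 ≠ 0) ?_
      rw [hbinom, ← hcatalan]
      ring
    rw [sum_range_succ, ih, hsucc, ← hcatalan]
    field_simp
    ring

theorem sum_range_catalan_div_le_one (N : ℕ) :
    ∑ n ∈ range N, (catalan n : ℝ) / (2 * 4 ^ n) ≤ 1 := by
  rw [sum_range_catalan_div]
  exact sub_le_self _ (by positivity)

theorem summable_catalan_div : Summable fun n : ℕ => (catalan n : ℝ) / (2 * 4 ^ n) :=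
  summable_of_sum_range_le (fun _ => by positivity) sum_range_catalan_div_le_one

theorem tsum_catalan_div_le_one : ∑' n : ℕ, (catalan n : ℝ) / (2 * 4 ^ n) ≤ 1 :=
  summable_catalan_div.tsum_le_of_sum_range_le sum_range_catalan_div_le_one

variable {A : Type*} [NormedRing A] [NormedAlgebra ℝ A] {a b : A}

/-- The power series of `1 - √(1 - z)` at `z = a`, an element `w` of the closed unit ball with
`(1 - w) ^ 2 = 1 - a` if `‖a‖ ≤ 1`. It provides square roots on real Hilbert spaces, where the
continuous functional calculus is not available. -/
noncomputable def oneSubSqrt (a : A) : A :=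
  ∑' n : ℕ, ((catalan n : ℝ) / (2 * 4 ^ n)) • a ^ (n + 1)

theorem norm_smul_pow_succ_le {c : ℝ} (hc : 0 ≤ c) (ha : ‖a‖ ≤ 1) (n : ℕ) :
    ‖c • a ^ (n + 1)‖ ≤ c := by
  rw [norm_smul, Real.norm_of_nonneg hc]
  refine mul_le_of_le_one_right hc ?_
  exact (norm_pow_le' a n.succ_pos).trans (pow_le_one₀ (norm_nonneg a) ha)

theorem norm_oneSubSqrt_le (ha : ‖a‖ ≤ 1) : ‖oneSubSqrt a‖ ≤ 1 :=
  (tsum_of_norm_bounded summable_catalan_div.hasSum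
    fun n => norm_smul_pow_succ_le (by positivity) ha n).trans tsum_catalan_div_le_one

theorem summable_norm_oneSubSqrt (ha : ‖a‖ ≤ 1) :
    Summable fun n : ℕ => ‖((catalan n : ℝ) / (2 * 4 ^ n)) • a ^ (n + 1)‖ :=
  .of_nonneg_of_le (fun _ => norm_nonneg _)
    (fun n => norm_smul_pow_succ_le (by positivity) ha n) summable_catalan_div

variable [CompleteSpace A]

theorem hasSum_oneSubSqrt (ha : ‖a‖ ≤ 1) :
    HasSum (fun n : ℕ => ((catalan n : ℝ) / (2 * 4 ^ n)) • a ^ (n + 1)) (oneSubSqrt a) :=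
  (summable_norm_oneSubSqrt ha).of_norm.hasSum

theorem commute_oneSubSqrt (h : Commute b a) (ha : ‖a‖ ≤ 1) : Commute b (oneSubSqrt a) := by
  refine ((hasSum_oneSubSqrt ha).mul_left b).unique ?_
  simpa only [((h.pow_right _).smul_right _).eq] using (hasSum_oneSubSqrt ha).mul_right b

theorem oneSubSqrt_mul_self (ha : ‖a‖ ≤ 1) :
    oneSubSqrt a * oneSubSqrt a = (2 : ℝ) • oneSubSqrt a - a := by
  have hs := summable_norm_oneSubSqrt ha
  have hconv (n : ℕ) :
      ∑ ij ∈ antidiagonal n, ((catalan ij.1 : ℝ) / (2 * 4 ^ ij.1)) • a ^ (ij.1 + 1) *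
        ((catalan ij.2 : ℝ) / (2 * 4 ^ ij.2)) • a ^ (ij.2 + 1) =
      (2 : ℝ) • ((catalan (n + 1) : ℝ) / (2 * 4 ^ (n + 1))) • a ^ (n + 1 + 1) := by
    rw [catalan_succ', Nat.cast_sum, sum_div, sum_smul, smul_sum]
    refine sum_congr rfl fun ij hij => ?_
    rw [HasAntidiagonal.mem_antidiagonal] at hij
    rw [smul_mul_smul_comm, ← pow_add, smul_smul, ← hij]
    congr 1
    · push_cast
      field_simp
      ring
    · congr 1
      ring
  rw [oneSubSqrt, tsum_mul_tsum_eq_tsum_sum_antidiagonal_of_summable_norm hs hs,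
    hs.of_norm.tsum_eq_zero_add]
  simp only [hconv]
  rw [tsum_const_smul'' (2 : ℝ), smul_add, smul_smul]
  simp

theorem one_sub_oneSubSqrt_mul_self (ha : ‖a‖ ≤ 1) :
    (1 - oneSubSqrt a) * (1 - oneSubSqrt a) = 1 - a := by
  rw [sub_mul, mul_sub, mul_sub, oneSubSqrt_mul_self ha, two_smul]
  simp only [one_mul, mul_one]
  abel

end PowerSeries

section PositiveOperators

variable {𝕜 H : Type*} [RCLike 𝕜] [NormedAddCommGroup H] [InnerProductSpace 𝕜 H]

open RCLike in
theorem apply_eq_zero_of_re_inner_self_eq_zero {S : H →L[𝕜] H} (hS : S.IsPositive) {x : H}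
    (hx : re (inner 𝕜 (S x) x) = 0) : S x = 0 := by
  let form : PreInnerProductSpace.Core 𝕜 H :=
    { inner := fun x y => inner 𝕜 (S x) y
      conj_inner_symm := fun x y => by rw [inner_conj_symm, hS.inner_left_eq_inner_right]
      re_inner_nonneg := hS.re_inner_nonneg_left
      add_left := fun x y z => by rw [map_add, inner_add_left]
      smul_left := fun x y r => by rw [map_smul, inner_smul_left] }
  have cauchy_schwarz :
      ‖inner 𝕜 (S x) (S x)‖ * ‖inner 𝕜 (S (S x)) x‖ ≤
        re (inner 𝕜 (S x) x) * re (inner 𝕜 (S (S x)) (S x)) :=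
    InnerProductSpace.Core.inner_mul_inner_self_le (c := form) x (S x)
  rw [hS.inner_left_eq_inner_right (S x) x, hx, zero_mul] at cauchy_schwarz
  exact inner_self_eq_zero.1 (norm_eq_zero.1 (mul_self_eq_zero.1
    (le_antisymm cauchy_schwarz (mul_self_nonneg _))))

theorem eq_of_isPositive_of_mul_self_eq {S S' : H →L[𝕜] H} (hS : S.IsPositive)
    (hS' : S'.IsPositive) (hcomm : Commute S S') (h : S * S = S' * S') : S = S' := by
  ext x
  set y := (S - S') x with hy
  have hsum : S y + S' y = 0 := by
    change ((S + S') * (S - S')) x = 0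
    rw [← hcomm.mul_self_sub_mul_self_eq, h, sub_self, zero_apply]
  have hre : RCLike.re (inner 𝕜 (S y) y) + RCLike.re (inner 𝕜 (S' y) y) = 0 := by
    rw [← map_add, ← inner_add_left, hsum, inner_zero_left, map_zero]
  have hle := hS.re_inner_nonneg_left y
  have hle' := hS'.re_inner_nonneg_left y
  have hSy : S y = 0 := apply_eq_zero_of_re_inner_self_eq_zero hS (by linarith)
  have hSy' : S' y = 0 := apply_eq_zero_of_re_inner_self_eq_zero hS' (by linarith)
  have hyy : inner 𝕜 y y = 0 := by
    nth_rewrite 1 [hy]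
    rw [sub_apply, inner_sub_left, hS.inner_left_eq_inner_right, hS'.inner_left_eq_inner_right,
      hSy, hSy', sub_self]
  exact sub_eq_zero.1 (inner_self_eq_zero.1 hyy)

theorem isPositive_of_norm_one_sub_le [CompleteSpace H] {S : H →L[𝕜] H} (hS : IsSelfAdjoint S)
    (h : ‖1 - S‖ ≤ 1) : S.IsPositive := by
  refine ContinuousLinearMap.isPositive_def'.2 ⟨hS, fun x => ?_⟩
  have hle : RCLike.re (inner 𝕜 ((1 - S) x) x) ≤ ‖x‖ * ‖x‖ :=
    (re_inner_le_norm _ _).trans <| by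
      gcongr
      simpa only [one_mul] using (1 - S).le_of_opNorm_le h x
  rw [sub_apply, inner_sub_left, map_sub, one_apply_eq_self,
    inner_self_eq_norm_mul_norm] at hle
  rw [ContinuousLinearMap.reApplyInnerSelf_apply]
  linarith

end PositiveOperators

section RealHilbertSpace

variable {H : Type*} [NormedAddCommGroup H] [InnerProductSpace ℝ H] [CompleteSpace H]
  {T : H →L[ℝ] H}

theorem isSelfAdjoint_oneSubSqrt (hT : IsSelfAdjoint T) : IsSelfAdjoint (oneSubSqrt T) := by
  rw [IsSelfAdjoint, oneSubSqrt, tsum_star]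
  simp only [star_smul, star_trivial, (hT.pow _).star_eq]

theorem existsUnique_isPositive_mul_self_eq_one_sub (hT : IsSelfAdjoint T) (hnorm : ‖T‖ ≤ 1) :
    ∃! S : H →L[ℝ] H, S.IsPositive ∧ S * S = 1 - T := by
  have hpos : (1 - oneSubSqrt T).IsPositive := by
    refine isPositive_of_norm_one_sub_le
      ((IsSelfAdjoint.one _).sub (isSelfAdjoint_oneSubSqrt hT)) ?_
    rw [sub_sub_cancel]
    exact norm_oneSubSqrt_le hnorm
  refine ⟨1 - oneSubSqrt T, ⟨hpos, one_sub_oneSubSqrt_mul_self hnorm⟩, fun S ⟨hS, hSS⟩ => ?_⟩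
  have hcomm : Commute S T := by
    rw [← sub_sub_cancel 1 T, ← hSS]
    exact (Commute.one_right S).sub_right ((Commute.refl S).mul_right (Commute.refl S))
  refine eq_of_isPositive_of_mul_self_eq hS hpos ?_ ?_
  · exact (Commute.one_right S).sub_right (commute_oneSubSqrt hcomm hnorm)
  · rw [hSS, one_sub_oneSubSqrt_mul_self hnorm]

end RealHilbertSpace

section NeumannSeries

open Filter Topology Finset

theorem geom_sum_mul_one_sub_pow {R : Type*} [Ring R] (x : R) (m n : ℕ) :
    (∑ i ∈ range m, x ^ i) * (1 - x ^ n) =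
      ∑ i ∈ range m, x ^ i + ∑ i ∈ range n, x ^ i - ∑ i ∈ range (m + n), x ^ i := by
  rw [add_comm m n, sum_range_add, mul_sub, mul_one, sum_mul]
  simp only [← pow_add, add_comm n]
  abel

variable {𝕜 H : Type*} [RCLike 𝕜] [NormedAddCommGroup H] [InnerProductSpace 𝕜 H]

theorem cauchy_map_of_tendsto_inner {ι : Type*} {l : Filter ι} [NeBot l] {u : ι → H} {c : 𝕜}
    (h : Tendsto (fun p : ι × ι => inner 𝕜 (u p.1) (u p.2)) (l ×ˢ l) (𝓝 c)) :
    Cauchy (map u l) := by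
  have hdiag : Tendsto (fun i => inner 𝕜 (u i) (u i)) l (𝓝 c) := h.comp tendsto_diag
  have hswap : Tendsto (fun p : ι × ι => inner 𝕜 (u p.2) (u p.1)) (l ×ˢ l) (𝓝 c) :=
    h.comp tendsto_prod_swap
  have hsub : Tendsto (fun p : ι × ι => inner 𝕜 (u p.1 - u p.2) (u p.1 - u p.2)) (l ×ˢ l)
      (𝓝 0) := by
    simpa only [Function.comp_def, inner_sub_left, inner_sub_right, sub_self] using
      ((hdiag.comp tendsto_fst).sub hswap).sub (h.sub (hdiag.comp tendsto_snd))
  have hnorm := ((RCLike.continuous_re.tendsto (0 : 𝕜)).comp hsub).sqrt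
  rw [map_zero, Real.sqrt_zero] at hnorm
  refine cauchy_map_iff'.2 (tendsto_uniformity_iff_dist_tendsto_zero.2 (hnorm.congr fun p => ?_))
  rw [dist_eq_norm, norm_eq_sqrt_re_inner (𝕜 := 𝕜) (u p.1 - u p.2)]
  rfl

variable [CompleteSpace H] {T S : H →L[𝕜] H} {f g : H} {c : 𝕜}

theorem inner_apply_geom_sum (hT : IsSelfAdjoint T) (hS : IsSelfAdjoint S)
    (hSS : S * S = 1 - T) (f g : H) (m n : ℕ) :
    inner 𝕜 (S ((∑ i ∈ range m, T ^ i) f)) (S ((∑ i ∈ range n, T ^ i) g)) =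
      ∑ i ∈ range m, inner 𝕜 f ((T ^ i) g) + ∑ i ∈ range n, inner 𝕜 f ((T ^ i) g) -
        ∑ i ∈ range (m + n), inner 𝕜 f ((T ^ i) g) := by
  have hsum : IsSelfAdjoint (∑ i ∈ range m, T ^ i) := isSelfAdjoint_sum _ fun i _ => hT.pow i
  rw [hS.isSymmetric.apply_clm, hsum.isSymmetric.apply_clm]
  change inner 𝕜 f (((∑ i ∈ range m, T ^ i) * ((S * S) * ∑ i ∈ range n, T ^ i)) g) = _
  rw [hSS, mul_neg_geom_sum, geom_sum_mul_one_sub_pow]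
  simp only [sub_apply, add_apply, _root_.sum_apply, inner_sub_right, inner_add_right,
    inner_sum]

theorem tendsto_inner_apply_geom_sum (hT : IsSelfAdjoint T) (hS : IsSelfAdjoint S)
    (hSS : S * S = 1 - T) (h : HasSum (fun n => inner 𝕜 f ((T ^ n) g)) c) :
    Tendsto (fun p : ℕ × ℕ =>
      inner 𝕜 (S ((∑ i ∈ range p.1, T ^ i) f)) (S ((∑ i ∈ range p.2, T ^ i) g)))
      (atTop ×ˢ atTop) (𝓝 c) := by
  have hlim := h.tendsto_sum_nat
  have key := ((hlim.comp tendsto_fst).add (hlim.comp tendsto_snd)).sub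
    (hlim.comp (tendsto_fst.atTop_add_atTop tendsto_snd))
  rw [add_sub_cancel_right] at key
  exact key.congr fun p => (inner_apply_geom_sum hT hS hSS f g p.1 p.2).symm

theorem tendsto_pow_apply_zero (hT : IsSelfAdjoint T)
    (h : Summable fun n => inner 𝕜 f ((T ^ n) f)) : Tendsto (fun n => (T ^ n) f) atTop (𝓝 0) := by
  have hdouble : Tendsto (fun n : ℕ => n + n) atTop atTop := tendsto_id.atTop_add_atTop tendsto_id
  have hzero := ((RCLike.continuous_re.tendsto (0 : 𝕜)).comp
    (h.tendsto_atTop_zero.comp hdouble)).sqrt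
  rw [map_zero, Real.sqrt_zero] at hzero
  refine tendsto_zero_iff_norm_tendsto_zero.2 (hzero.congr fun n => ?_)
  rw [norm_eq_sqrt_re_inner (𝕜 := 𝕜) ((T ^ n) f), (hT.pow n).isSymmetric.apply_clm,
    ← mul_apply_eq_comp, ← pow_add]
  rfl

theorem exists_tendsto_apply_geom_sum (hT : IsSelfAdjoint T) (hS : IsSelfAdjoint S)
    (hSS : S * S = 1 - T) (h : Summable fun n => inner 𝕜 f ((T ^ n) f)) :
    ∃ k, S k = f ∧ Tendsto (fun n => S ((∑ i ∈ range n, T ^ i) f)) atTop (𝓝 k) := by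
  have hcauchy : CauchySeq fun n => S ((∑ i ∈ range n, T ^ i) f) :=
    cauchy_map_of_tendsto_inner (tendsto_inner_apply_geom_sum hT hS hSS h.hasSum)
  obtain ⟨k, hk⟩ := cauchySeq_tendsto_of_complete hcauchy
  have hSk : Tendsto (fun n => S (S ((∑ i ∈ range n, T ^ i) f))) atTop (𝓝 (S k)) :=
    (S.continuous.tendsto k).comp hk
  have hf : Tendsto (fun n => f - (T ^ n) f) atTop (𝓝 f) := by
    simpa only [sub_zero] using (tendsto_pow_apply_zero hT h).const_sub f
  have happly (n : ℕ) : S (S ((∑ i ∈ range n, T ^ i) f)) = f - (T ^ n) f := by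
    change ((S * S) * ∑ i ∈ range n, T ^ i) f = (1 - T ^ n) f
    rw [hSS, mul_neg_geom_sum]
  simp only [happly] at hSk
  exact ⟨k, tendsto_nhds_unique hSk hf, hk⟩

theorem exists_preimages_of_hasSum_inner {ι : Type*} (hT : IsSelfAdjoint T)
    (hS : IsSelfAdjoint S) (hSS : S * S = 1 - T) {f : ι → H} {c : ι → ι → 𝕜}
    (h : ∀ i j, HasSum (fun n => inner 𝕜 (f i) ((T ^ n) (f j))) (c i j)) :
    ∃ k : ι → H, (∀ i, S (k i) = f i) ∧ ∀ i j, inner 𝕜 (k i) (k j) = c i j := by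
  choose k hSk hk using fun i => exists_tendsto_apply_geom_sum hT hS hSS (h i i).summable
  refine ⟨k, hSk, fun i j => ?_⟩
  have hinner := (hk i).inner (𝕜 := 𝕜) (hk j)
  have hdiag := (tendsto_inner_apply_geom_sum hT hS hSS (h i j)).comp tendsto_diag
  exact tendsto_nhds_unique hinner hdiag

theorem injective_of_orthogonal_span_eq_bot {s : Set H} (hS : IsSelfAdjoint S)
    (hs : s ⊆ Set.range S) (hdense : (Submodule.span 𝕜 s)ᗮ = ⊥) : Function.Injective S := by
  refine LinearMap.ker_eq_bot.1 (eq_bot_iff.2 ?_)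
  rw [← hS.isSymmetric.orthogonal_range, ← hdense]
  exact Submodule.orthogonal_le (Submodule.span_le.2 hs)

end NeumannSeries

section InverseSquareRoot

variable {R E F : Type*} [Ring R] [AddCommGroup E] [AddCommGroup F] [Module R E] [Module R F]

theorem mem_domain_inverse_toPMap (S : E →ₗ[R] F) (x : E) : S x ∈ (S.toPMap ⊤).inverse.domain := by
  rw [LinearPMap.inverse_domain]
  exact ⟨⟨x, trivial⟩, rfl⟩

theorem inverse_toPMap_apply {S : E →ₗ[R] F} (hS : Function.Injective S) (x : E) :
    (S.toPMap ⊤).inverse ⟨S x, mem_domain_inverse_toPMap S x⟩ = x := by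
  have hker : LinearMap.ker (S.toPMap ⊤).toFun = ⊥ :=
    LinearMap.ker_eq_bot.2 fun _ _ hxy => Subtype.ext (hS hxy)
  exact LinearPMap.inverse_apply_eq hker (x := ⟨x, trivial⟩) rfl

variable {H : Type*} [NormedAddCommGroup H] [InnerProductSpace ℝ H] [CompleteSpace H]
  {T : H →L[ℝ] H}

theorem exists_isInvSqrt_one_sub {ι : Type*} (hT : IsSelfAdjoint T) (hnorm : ‖T‖ ≤ 1)
    {f : ι → H} {c : ι → ι → ℝ}
    (hsum : ∀ i j, HasSum (fun n => inner ℝ (f i) ((T ^ n) (f j))) (c i j))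
    (hdense : (Submodule.span ℝ (Set.range f))ᗮ = ⊥) :
    ∃ R : H →ₗ.[ℝ] H, IsInvSqrt R (1 - T) ∧ (∀ R', IsInvSqrt R' (1 - T) → R' = R) ∧
      ∃ hdom : ∀ i, f i ∈ R.domain, ∀ i j, inner ℝ (R ⟨f i, hdom i⟩) (R ⟨f j, hdom j⟩) = c i j := by
  obtain ⟨S, ⟨hS, hSS⟩, huniq⟩ := existsUnique_isPositive_mul_self_eq_one_sub hT hnorm
  obtain ⟨k, hSk, hk⟩ := exists_preimages_of_hasSum_inner hT hS.isSelfAdjoint hSS hsum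
  obtain rfl : f = fun i => S (k i) := funext fun i => (hSk i).symm
  have hinj : Function.Injective S := by
    refine injective_of_orthogonal_span_eq_bot hS.isSelfAdjoint ?_ hdense
    exact Set.range_subset_iff.2 fun i => ⟨k i, rfl⟩
  refine ⟨_, ⟨S, hS, hSS, hinj, rfl⟩, ?_,
    fun i => mem_domain_inverse_toPMap (S : H →ₗ[ℝ] H) (k i), fun i j => ?_⟩
  · rintro _ ⟨S', hS', hSS', -, rfl⟩
    rw [huniq S' ⟨hS', hSS'⟩]
  · rw [← hk i j]
    exact congrArg₂ _ (inverse_toPMap_apply hinj (k i)) (inverse_toPMap_apply hinj (k j))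

end InverseSquareRoot

section MarkovOperator

instance isMarkovKernel_pow {X : Type*} [MeasurableSpace X] (κ : Kernel X X) [IsMarkovKernel κ]
    (n : ℕ) : IsMarkovKernel (κ ^ n) := by
  induction n with
  | zero => exact inferInstanceAs (IsMarkovKernel (Kernel.id : Kernel X X))
  | succ n ih => exact inferInstanceAs (IsMarkovKernel ((κ ^ n) ∘ₖ κ))

theorem pow_comp_eq_of_comp_eq {X : Type*} [MeasurableSpace X] {ν : Measure X} {κ : Kernel X X}
    (h : κ ∘ₘ ν = ν) (n : ℕ) : (κ ^ n : Kernel X X) ∘ₘ ν = ν := by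
  induction n with
  | zero => exact Measure.id_comp
  | succ n ih => rw [Kernel.pow_add, pow_one, ← Measure.comp_assoc, h, ih]

variable {X Y : Type*} [MeasurableSpace X] [MeasurableSpace Y] {ν : Measure X} {μ : Measure Y}
  {κ : Kernel X Y} [IsMarkovKernel κ]

theorem measurePreserving_fst_compProd [SFinite ν] : MeasurePreserving Prod.fst (ν ⊗ₘ κ) ν :=
  ⟨measurable_fst, Measure.fst_compProd ν κ⟩

theorem measurePreserving_snd_compProd [SFinite ν] (h : κ ∘ₘ ν = μ) :
    MeasurePreserving Prod.snd (ν ⊗ₘ κ) μ :=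
  ⟨measurable_snd, (Measure.snd_compProd ν κ).trans h⟩

variable (𝕜 : Type*) [RCLike 𝕜]

/-- The isometric embedding of `L²(ν)` into `L²(ν ⊗ₘ κ)` as functions of the first variable. -/
noncomputable def compFst (ν : Measure X) [SFinite ν] (κ : Kernel X Y) [IsMarkovKernel κ] :
    Lp 𝕜 2 ν →ₗᵢ[𝕜] Lp 𝕜 2 (ν ⊗ₘ κ) :=
  Lp.compMeasurePreservingₗᵢ 𝕜 Prod.fst measurePreserving_fst_compProd

/-- The isometric embedding of `L²(μ)` into `L²(ν ⊗ₘ κ)` as functions of the second variable, where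
`μ` is the image of `ν` under `κ`. -/
noncomputable def compSnd [SFinite ν] (h : κ ∘ₘ ν = μ) : Lp 𝕜 2 μ →ₗᵢ[𝕜] Lp 𝕜 2 (ν ⊗ₘ κ) :=
  Lp.compMeasurePreservingₗᵢ 𝕜 Prod.snd (measurePreserving_snd_compProd h)

/-- The operator `φ ↦ (x ↦ ∫ φ(y) κ(x, dy))` from `L²(μ)` to `L²(ν)`, where `μ` is the image of `ν`
under the Markov kernel `κ`. As the integral only makes sense for almost every `x`, the operator is
defined instead as a conditional expectation: `φ` is regarded as a function of the second variable
in `L²(ν ⊗ₘ κ)` and projected onto the functions of the first variable. -/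
noncomputable def markovOperator [SFinite ν] (h : κ ∘ₘ ν = μ) : Lp 𝕜 2 μ →L[𝕜] Lp 𝕜 2 ν :=
  (compFst 𝕜 ν κ).toContinuousLinearMap.adjoint ∘L (compSnd 𝕜 h).toContinuousLinearMap

variable {𝕜}

theorem inner_markovOperator [SFinite ν] (h : κ ∘ₘ ν = μ) (ψ : Lp 𝕜 2 ν) (φ : Lp 𝕜 2 μ) :
    inner 𝕜 ψ (markovOperator 𝕜 h φ) = inner 𝕜 (compFst 𝕜 ν κ ψ) (compSnd 𝕜 h φ) := by
  rw [markovOperator, ContinuousLinearMap.comp_apply, ContinuousLinearMap.adjoint_inner_right]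
  rfl

theorem norm_markovOperator_le [SFinite ν] (h : κ ∘ₘ ν = μ) : ‖markovOperator 𝕜 h‖ ≤ 1 := by
  refine (ContinuousLinearMap.opNorm_comp_le _ _).trans (mul_le_one₀ ?_ (norm_nonneg _) ?_)
  · rw [LinearIsometryEquiv.norm_map]
    exact LinearIsometry.norm_toContinuousLinearMap_le _
  · exact LinearIsometry.norm_toContinuousLinearMap_le _

theorem compFst_indicatorConstLp [SFinite ν] {s : Set X} (hs : MeasurableSet s) (hνs : ν s ≠ ∞)
    (c : 𝕜) :
    compFst 𝕜 ν κ (indicatorConstLp 2 hs hνs c) =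
      indicatorConstLp 2 (hs.preimage measurable_fst)
        ((measurePreserving_fst_compProd.measure_preimage hs.nullMeasurableSet).trans_ne hνs) c :=
  rfl

theorem compSnd_indicatorConstLp [SFinite ν] (h : κ ∘ₘ ν = μ) {t : Set Y} (ht : MeasurableSet t)
    (hμt : μ t ≠ ∞) (c : 𝕜) :
    compSnd 𝕜 h (indicatorConstLp 2 ht hμt c) =
      indicatorConstLp 2 (ht.preimage measurable_snd)
        (((measurePreserving_snd_compProd h).measure_preimage ht.nullMeasurableSet).trans_ne hμt)
        c :=
  rfl

theorem inner_indicatorConstLp_markovOperator [SFinite ν] (h : κ ∘ₘ ν = μ) {s : Set X} {t : Set Y}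
    (hs : MeasurableSet s) (hνs : ν s ≠ ∞) (ht : MeasurableSet t) (hμt : μ t ≠ ∞) :
    inner 𝕜 (indicatorConstLp 2 hs hνs (1 : 𝕜))
        (markovOperator 𝕜 h (indicatorConstLp 2 ht hμt (1 : 𝕜))) =
      (((ν ⊗ₘ κ).real (s ×ˢ t) : ℝ) : 𝕜) := by
  rw [inner_markovOperator, compFst_indicatorConstLp, compSnd_indicatorConstLp,
    L2.inner_indicatorConstLp_one_indicatorConstLp_one _ _ _ _, Set.prod_eq]

theorem adjoint_markovOperator [SFinite ν] [SFinite μ] {η : Kernel Y X} [IsMarkovKernel η]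
    (hκ : κ ∘ₘ ν = μ) (hη : η ∘ₘ μ = ν) (hswap : (ν ⊗ₘ κ).map Prod.swap = μ ⊗ₘ η) :
    (markovOperator 𝕜 hκ).adjoint = markovOperator 𝕜 hη := by
  let W : Lp 𝕜 2 (μ ⊗ₘ η) →ₗᵢ[𝕜] Lp 𝕜 2 (ν ⊗ₘ κ) :=
    Lp.compMeasurePreservingₗᵢ 𝕜 Prod.swap ⟨measurable_swap, hswap⟩
  have hfst (ψ : Lp 𝕜 2 ν) : W (compSnd 𝕜 hη ψ) = compFst 𝕜 ν κ ψ :=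
    (Lp.compMeasurePreserving_comp_apply ψ _ _).symm
  have hsnd (φ : Lp 𝕜 2 μ) : W (compFst 𝕜 μ η φ) = compSnd 𝕜 hκ φ :=
    (Lp.compMeasurePreserving_comp_apply φ _ _).symm
  refine ((ContinuousLinearMap.eq_adjoint_iff _ _).2 fun ψ φ => ?_).symm
  rw [inner_markovOperator, ← hfst, ← hsnd, W.inner_map_map, ← inner_conj_symm,
    inner_markovOperator, inner_conj_symm]

theorem isSelfAdjoint_markovOperator [SFinite ν] {κ : Kernel X X} [IsMarkovKernel κ]
    (h : κ ∘ₘ ν = ν) (hswap : (ν ⊗ₘ κ).map Prod.swap = ν ⊗ₘ κ) :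
    IsSelfAdjoint (markovOperator 𝕜 h) :=
  adjoint_markovOperator h h hswap

theorem integrable_comp_restrict (h : κ ∘ₘ ν = μ) {φ : Y → 𝕜} (hφ : MemLp φ 2 μ) {s : Set X}
    (hνs : ν s < ∞) : Integrable φ (κ ∘ₘ ν.restrict s) := by
  have : IsFiniteMeasure (ν.restrict s) := isFiniteMeasure_restrict.2 hνs.ne
  have hle : κ ∘ₘ ν.restrict s ≤ μ := by
    rw [← h]
    refine Measure.le_iff.2 fun t ht => ?_
    rw [Measure.bind_apply ht κ.aemeasurable, Measure.bind_apply ht κ.aemeasurable]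
    exact setLIntegral_le_lintegral s _
  exact (hφ.mono_measure hle).integrable one_le_two

theorem ae_integrable_of_memLp_two [SigmaFinite ν] (h : κ ∘ₘ ν = μ) {φ : Y → 𝕜}
    (hφ : MemLp φ 2 μ) : ∀ᵐ x ∂ν, Integrable φ (κ x) :=
  ae_of_forall_measure_lt_top_ae_restrict _ fun _ _ hνs =>
    Measure.ae_integrable_of_integrable_comp (integrable_comp_restrict h hφ hνs)

theorem integrableOn_integral_kernel (h : κ ∘ₘ ν = μ) {φ : Y → 𝕜} (hφ : MemLp φ 2 μ) {s : Set X}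
    (hνs : ν s < ∞) : IntegrableOn (fun x => ∫ y, φ y ∂κ x) s ν := by
  have hint := integrable_comp_restrict h hφ hνs
  rw [Measure.comp_eq_comp_const_apply] at hint
  exact hint.integral_comp

theorem coeFn_markovOperator [SigmaFinite ν] (h : κ ∘ₘ ν = μ) (φ : Lp 𝕜 2 μ) :
    markovOperator 𝕜 h φ =ᵐ[ν] fun x => ∫ y, φ y ∂κ x := by
  refine ae_eq_of_forall_setIntegral_eq_of_sigmaFinite
    (fun s _ hνs => integrableOn_Lp_of_measure_ne_top _ Fact.out hνs.ne)
    (fun s _ hνs => integrableOn_integral_kernel h (Lp.memLp φ) hνs) fun s hs hνs => ?_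
  have hsnd : compSnd 𝕜 h φ =ᵐ[(ν ⊗ₘ κ).restrict (Prod.fst ⁻¹' s)] fun z => φ z.2 :=
    ae_restrict_of_ae (Lp.coeFn_compMeasurePreserving φ (measurePreserving_snd_compProd h))
  have hint : IntegrableOn (fun z => φ z.2) (Prod.fst ⁻¹' s) (ν ⊗ₘ κ) := by
    refine Integrable.congr (integrableOn_Lp_of_measure_ne_top _ Fact.out ?_) hsnd
    rw [measurePreserving_fst_compProd.measure_preimage hs.nullMeasurableSet]
    exact hνs.ne
  rw [← L2.inner_indicatorConstLp_one hs hνs.ne, inner_markovOperator, compFst_indicatorConstLp,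
    L2.inner_indicatorConstLp_one, integral_congr_ae hsnd]
  rw [← Set.prod_univ] at hint ⊢
  rw [Measure.setIntegral_compProd hs .univ hint]
  simp only [Measure.restrict_univ]

theorem markovOperator_comp {Z : Type*} [MeasurableSpace Z] {ρ : Measure Z} {η : Kernel Y Z}
    [IsMarkovKernel η] [SigmaFinite ν] [SigmaFinite μ] (hκ : κ ∘ₘ ν = μ) (hη : η ∘ₘ μ = ρ)
    (hηκ : (η ∘ₖ κ) ∘ₘ ν = ρ) :
    markovOperator 𝕜 hηκ = markovOperator 𝕜 hκ ∘L markovOperator 𝕜 hη := by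
  ext1 φ
  refine Lp.ext ?_
  have hφ : ∀ᵐ x ∂ν, markovOperator 𝕜 hη φ =ᵐ[κ x] fun y => ∫ z, φ z ∂η y :=
    Measure.ae_ae_of_ae_comp (hκ ▸ coeFn_markovOperator hη φ)
  filter_upwards [coeFn_markovOperator hηκ φ, coeFn_markovOperator hκ (markovOperator 𝕜 hη φ), hφ,
    ae_integrable_of_memLp_two hηκ (Lp.memLp φ)] with x hx₁ hx₂ hx₃ hint
  rw [hx₁, ContinuousLinearMap.comp_apply, hx₂, integral_congr_ae hx₃, Kernel.integral_comp hint]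

theorem markovOperator_id [SigmaFinite ν] (h : Kernel.id ∘ₘ ν = ν) :
    markovOperator 𝕜 h = 1 := by
  ext1 φ
  refine Lp.ext ((coeFn_markovOperator h φ).trans (.of_forall fun x => ?_))
  simp [Kernel.id_apply, integral_dirac' _ _ (Lp.stronglyMeasurable φ)]

theorem markovOperator_pow [SigmaFinite ν] {κ : Kernel X X} [IsMarkovKernel κ]
    (h : κ ∘ₘ ν = ν) (n : ℕ) :
    markovOperator 𝕜 (pow_comp_eq_of_comp_eq h n) = markovOperator 𝕜 h ^ n := by
  induction n with
  | zero => exact markovOperator_id _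
  | succ n ih =>
    calc markovOperator 𝕜 (pow_comp_eq_of_comp_eq h (n + 1))
        = markovOperator 𝕜 h ∘L markovOperator 𝕜 (pow_comp_eq_of_comp_eq h n) :=
          markovOperator_comp (η := κ ^ n) h _ _
      _ = markovOperator 𝕜 h ^ (n + 1) := by rw [ih, pow_succ', ContinuousLinearMap.mul_def]

end MarkovOperator

section Reversible

theorem ext_of_prod_eq_of_measure_lt_top {X Y : Type*} [MeasurableSpace X] [MeasurableSpace Y]
    {ν : Measure X} {μ : Measure Y} [SigmaFinite ν] [SigmaFinite μ] {ρ σ : Measure (X × Y)}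
    (hfin : ∀ s t, MeasurableSet s → MeasurableSet t → ν s < ∞ → μ t < ∞ → ρ (s ×ˢ t) < ∞)
    (heq : ∀ s t, MeasurableSet s → MeasurableSet t → ν s < ∞ → μ t < ∞ →
      ρ (s ×ˢ t) = σ (s ×ˢ t)) : ρ = σ := by
  refine (Measure.ext_iff_of_iUnion_eq_univ (s := fun n => spanningSets ν n ×ˢ spanningSets μ n)
    ?_).2 fun n => ?_
  · rw [Set.iUnion_prod_of_monotone (monotone_spanningSets ν) (monotone_spanningSets μ),
      iUnion_spanningSets, iUnion_spanningSets, Set.univ_prod_univ]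
  have hS := measurableSet_spanningSets ν n
  have hT := measurableSet_spanningSets μ n
  have hνS := measure_spanningSets_lt_top ν n
  have hμT := measure_spanningSets_lt_top μ n
  have : IsFiniteMeasure (ρ.restrict (spanningSets ν n ×ˢ spanningSets μ n)) :=
    isFiniteMeasure_restrict.2 (hfin _ _ hS hT hνS hμT).ne
  refine Measure.ext_prod fun {s t} hs ht => ?_
  rw [Measure.restrict_apply (hs.prod ht), Measure.restrict_apply (hs.prod ht), Set.prod_inter_prod]
  exact heq _ _ (hs.inter hS) (ht.inter hT) (measure_inter_lt_top_of_right_ne_top hνS.ne)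
    (measure_inter_lt_top_of_right_ne_top hμT.ne)

variable {X : Type*} [MeasurableSpace X] {ν : Measure X} {P : Kernel X X}

theorem Reversible.map_swap_compProd [SigmaFinite ν] [IsMarkovKernel P] (hrev : Reversible P ν) :
    (ν ⊗ₘ P).map Prod.swap = ν ⊗ₘ P := by
  symm
  refine ext_of_prod_eq_of_measure_lt_top (ν := ν) (μ := ν) (fun s t hs _ hνs _ => ?_)
    fun s t hs ht hνs hνt => ?_
  · calc (ν ⊗ₘ P) (s ×ˢ t) ≤ (ν ⊗ₘ P) (Prod.fst ⁻¹' s) := measure_mono fun z hz => hz.1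
      _ = ν s := measurePreserving_fst_compProd.measure_preimage hs.nullMeasurableSet
      _ < ∞ := hνs
  · rw [Measure.map_apply measurable_swap (hs.prod ht), Set.preimage_swap_prod,
      Measure.compProd_apply_prod hs ht, Measure.compProd_apply_prod ht hs]
    exact hrev ⟨s, hs, hνs⟩ ⟨t, ht, hνt⟩

theorem Reversible.comp_eq [SigmaFinite ν] [IsMarkovKernel P] (hrev : Reversible P ν) :
    P ∘ₘ ν = ν := by
  rw [← Measure.snd_compProd, ← Measure.fst_map_swap, hrev.map_swap_compProd, Measure.fst_compProd]

theorem isInducedOperator_markovOperator [SigmaFinite ν] [IsMarkovKernel P] (h : P ∘ₘ ν = ν) :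
    IsInducedOperator P ν (markovOperator ℝ h) := by
  refine fun φ hφ => ⟨ae_integrable_of_memLp_two h hφ, ?_⟩
  have hcoe : ∀ᵐ x ∂ν, hφ.toLp φ =ᵐ[P x] φ := Measure.ae_ae_of_ae_comp (h.symm ▸ hφ.coeFn_toLp)
  filter_upwards [coeFn_markovOperator h (hφ.toLp φ), hcoe] with x hx hφx
  rw [hx, integral_congr_ae hφx]

theorem hasSum_greenKernel (htrans : Transient P ν) (A B : BFin ν) :
    HasSum (fun n => (∫⁻ x in A, (P ^ n) x B ∂ν).toReal) (greenKernel P ν A B) := by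
  have hgreen : ∫⁻ x in A, green P x B ∂ν = ∑' n, ∫⁻ x in A, (P ^ n) x B ∂ν :=
    lintegral_tsum fun n => ((P ^ n).measurable_coe B.2.1).aemeasurable
  have hfin := htrans.2 A B
  rw [hgreen] at hfin
  rw [greenKernel, hgreen, ENNReal.tsum_toReal_eq (ENNReal.ne_top_of_tsum_ne_top hfin.ne)]
  exact ENNReal.hasSum_toReal hfin.ne

theorem hasSum_inner_chi_markovOperator_pow [SigmaFinite ν] [IsMarkovKernel P] (h : P ∘ₘ ν = ν)
    (htrans : Transient P ν) (A B : BFin ν) :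
    HasSum (fun n => inner ℝ (chi ν A) ((markovOperator ℝ h ^ n) (chi ν B)))
      (greenKernel P ν A B) := by
  refine (hasSum_greenKernel htrans A B).congr_fun fun n => ?_
  rw [← markovOperator_pow, chi, chi, inner_indicatorConstLp_markovOperator, measureReal_def,
    Measure.compProd_apply_prod A.2.1 B.2.1]
  rfl

theorem orthogonal_span_range_chi (ν : Measure X) :
    (Submodule.span ℝ (Set.range (chi ν)))ᗮ = ⊥ := by
  refine (Submodule.eq_bot_iff _).2 fun φ hφ => Lp.eq_zero_iff_ae_eq_zero.2 ?_
  refine Lp.ae_eq_zero_of_forall_setIntegral_eq_zero φ two_ne_zero ENNReal.ofNat_ne_top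
    (fun s _ hνs => integrableOn_Lp_of_measure_ne_top φ Fact.out hνs.ne) fun s hs hνs => ?_
  rw [← L2.inner_indicatorConstLp_one hs hνs.ne]
  exact hφ _ (Submodule.subset_span ⟨⟨s, hs, hνs⟩, rfl⟩)

end Reversible

section Realization

variable {X : Type*} [MeasurableSpace X] {ν : Measure X} {K : BFin ν → BFin ν → ℝ}
  {k : BFin ν → Lp ℝ 2 ν}

theorem isL2Realization_iff : IsL2Realization K k ↔ ∀ A B, inner ℝ (k A) (k B) = K A B := by
  refine forall₂_congr fun A B => ?_
  rw [eq_comm, L2.inner_def]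
  simp only [RCLike.inner_apply', conj_trivial]

theorem IsL2Realization.isPosDefKernel (hk : IsL2Realization K k) : IsPosDefKernel K := by
  intro n α A
  calc 0 ≤ inner ℝ (∑ i, α i • k (A i)) (∑ i, α i • k (A i)) := real_inner_self_nonneg
    _ = ∑ i, ∑ j, α i * α j * K (A i) (A j) := by
      rw [sum_inner]
      simp only [inner_sum, real_inner_smul_left, real_inner_smul_right,
        isL2Realization_iff.1 hk, mul_assoc, mul_left_comm]

end Realization

end TransientMarkov

open TransientMarkov in
theorem mainTheorem4 {X : Type*} [MeasurableSpace X] (ν : Measure X) [SigmaFinite ν]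
    (P : Kernel X X) [IsMarkovKernel P] (hrev : Reversible P ν) (htrans : Transient P ν) :
    IsPosDefKernel (greenKernel P ν) ∧
      ∃ Pν : Lp ℝ 2 ν →L[ℝ] Lp ℝ 2 ν,
        IsInducedOperator P ν Pν ∧ IsSelfAdjoint Pν ∧ ‖Pν‖ ≤ 1 ∧
          ∃ R : Lp ℝ 2 ν →ₗ.[ℝ] Lp ℝ 2 ν,
            IsInvSqrt R (1 - Pν) ∧ (∀ R', IsInvSqrt R' (1 - Pν) → R' = R) ∧
              ∃ hdom : ∀ A : BFin ν, chi ν A ∈ R.domain,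
                IsL2Realization (greenKernel P ν) (fun A => R ⟨chi ν A, hdom A⟩) := by
  have hinv : P ∘ₘ ν = ν := hrev.comp_eq
  have hself : IsSelfAdjoint (markovOperator ℝ hinv) :=
    isSelfAdjoint_markovOperator hinv hrev.map_swap_compProd
  have hnorm : ‖markovOperator ℝ hinv‖ ≤ 1 := norm_markovOperator_le hinv
  obtain ⟨R, hR, hunique, hdom, hinner⟩ := exists_isInvSqrt_one_sub hself hnorm
    (hasSum_inner_chi_markovOperator_pow hinv htrans) (orthogonal_span_range_chi ν)
  have hreal : IsL2Realization (greenKernel P ν) fun A => R ⟨chi ν A, hdom A⟩ :=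
    isL2Realization_iff.2 hinner
  exact ⟨hreal.isPosDefKernel, markovOperator ℝ hinv, isInducedOperator_markovOperator hinv,
    hself, hnorm, R, hR, hunique, hdom, hreal⟩
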